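/- For a positive integer $n$ let $$F_n(x) = 1 + x + \frac{x^2}{2} + \cdots + \frac{x^n}{n} \in \mathbf{Q}[x],$$ and let $\operatorname{disc}(F_n) = (-1)^{\binom{n}{2}} a_n^{-1} \operatorname{Res}(F_n, F_n')$ be its discriminant, where $a_n = 1/n$ is the leading coefficient of $F_n$. For every prime number $q$, if $n = 3q$, $5q$ or $7q$, then $\operatorname{disc}(F_n)$ is not the square of a rational number. -/

import Mathlib

/-- The truncated logarithmic polynomial `F_n(x) = 1 + x + x^2/2 + ⋯ + x^n/n` over the rationals:
the truncation at degree `n` of the Maclaurin series of `1 - log (1 - x)`. -/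
noncomputable def truncatedLogPoly (n : ℕ) : Polynomial ℚ :=
  1 + ∑ k ∈ Finset.Icc 1 n, Polynomial.C (1 / (k : ℚ)) * Polynomial.X ^ k

/-! Since F_n' = 1 + x + ⋯ + x^(n-1), its roots are the n-th roots of unity other than 1. With a
common denominator L = ℓ^m u, ℓ ∤ u, ℓ^m ≤ n < ℓ^(m+1), the integer R = Res(L F_n, F_n') satisfies
L^(n-1) disc(F_n) = ± n R, and modulo ℓ only the terms of L F_n whose exponent is a multiple of ℓ^m
survive.

Write n = pq with p in {3, 5, 7}. For q > p take ℓ = q: if R is a unit mod q, then v_q(disc) is odd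
(`not_isSquare_discr_of_coprime`). A zero of R mod q gives w with w^p = 1 and ∑_{j ≤ p} w^j / j = 0,
which by a Bézout identity forces q to divide an explicit integer.

The finitely many q left over yield to other arguments: for n ≡ 3 mod 4 the discriminant is
negative; for n ≡ 1 mod 4 a square discriminant makes n R a square, which is refuted modulo a
suitable prime; for n even a prime ℓ with n/2 < ℓ < n has odd valuation. -/

open Polynomial Finset

/-! ### Integral model and discriminant formula -/

/-- The multiple `L * F_n` of the truncated logarithmic polynomial, with natural number coefficients
`L / k` viewed in `ℤ`. -/
noncomputable def clearedLogPoly (L n : ℕ) : ℤ[X] :=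
  C (L : ℤ) + ∑ k ∈ Icc 1 n, C ((L / k : ℕ) : ℤ) * X ^ k

/-- The resultant of `L * F_n` and `1 + X + ⋯ + X ^ (n - 1)`. -/
noncomputable def clearedResultant (L n : ℕ) : ℤ :=
  resultant (clearedLogPoly L n) (∑ i ∈ range n, X ^ i) n (n - 1)

lemma map_clearedLogPoly {L n : ℕ} (hL : ∀ k ∈ Icc 1 n, k ∣ L) :
    (clearedLogPoly L n).map (Int.castRingHom ℚ) = C (L : ℚ) * truncatedLogPoly n := by
  simp only [clearedLogPoly, truncatedLogPoly, Polynomial.map_add, Polynomial.map_sum,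
    Polynomial.map_mul, Polynomial.map_pow, map_X, map_C, mul_add, mul_one, Finset.mul_sum]
  congr 1
  refine Finset.sum_congr rfl fun k hk => ?_
  have hk0 : (k : ℚ) ≠ 0 := by
    have := (Finset.mem_Icc.1 hk).1
    positivity
  rw [← mul_assoc, ← C_mul]
  congr 2
  rw [eq_intCast, Int.cast_natCast, Nat.cast_div (hL k hk) hk0, mul_one_div]

lemma natDegree_clearedLogPoly_le (L n : ℕ) : (clearedLogPoly L n).natDegree ≤ n := by
  refine natDegree_add_le_of_degree_le (by simp) (natDegree_sum_le_of_forall_le _ _ fun k hk => ?_)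
  exact (natDegree_C_mul_X_pow_le _ _).trans (Finset.mem_Icc.1 hk).2

lemma natDegree_truncatedLogPoly {n : ℕ} (hn : 0 < n) : (truncatedLogPoly n).natDegree = n := by
  refine natDegree_eq_of_le_of_coeff_ne_zero ?_ ?_
  · refine natDegree_add_le_of_degree_le (by simp)
      (natDegree_sum_le_of_forall_le _ _ fun k hk => ?_)
    exact (natDegree_C_mul_X_pow_le _ _).trans (Finset.mem_Icc.1 hk).2
  · have h1 : (1 : ℚ[X]).coeff n = 0 := by simp [coeff_one, hn.ne']
    simp [truncatedLogPoly, finsetSum_coeff, h1, coeff_X_pow, hn.ne']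

lemma leadingCoeff_truncatedLogPoly {n : ℕ} (hn : 0 < n) :
    (truncatedLogPoly n).leadingCoeff = (n : ℚ)⁻¹ := by
  have h1 : (1 : ℚ[X]).coeff n = 0 := by simp [coeff_one, hn.ne']
  rw [leadingCoeff, natDegree_truncatedLogPoly hn]
  simp [truncatedLogPoly, finsetSum_coeff, h1, coeff_X_pow]
  omega

lemma derivative_truncatedLogPoly (n : ℕ) :
    derivative (truncatedLogPoly n) = ∑ i ∈ range n, X ^ i := by
  simp only [truncatedLogPoly, derivative_add, derivative_one, zero_add, derivative_sum]
  rw [← Finset.Ico_add_one_right_eq_Icc, Finset.sum_Ico_eq_sum_range, Nat.add_sub_cancel]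
  refine Finset.sum_congr rfl fun i _ => ?_
  have hi : ((1 + i : ℕ) : ℚ) ≠ 0 := by positivity
  rw [derivative_C_mul_X_pow, one_div, inv_mul_cancel₀ hi, C_1, one_mul, Nat.add_sub_cancel_left]

lemma cast_clearedResultant {K : Type*} [CommRing K] (L n : ℕ) :
    (clearedResultant L n : K) = resultant ((clearedLogPoly L n).map (Int.castRingHom K))
      (∑ i ∈ range n, X ^ i) n (n - 1) := by
  rw [clearedResultant, ← eq_intCast (Int.castRingHom K), ← resultant_map_map]
  congr 1
  simp [Polynomial.map_sum]

theorem pow_mul_discr_truncatedLogPoly {L n : ℕ} (hn : 0 < n) (hL : ∀ k ∈ Icc 1 n, k ∣ L) :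
    (L : ℚ) ^ (n - 1) * (truncatedLogPoly n).discr =
      (-1) ^ (n * (n - 1) / 2) * n * clearedResultant L n := by
  have hdeg : 0 < (truncatedLogPoly n).degree := by
    rw [← natDegree_pos_iff_degree_pos, natDegree_truncatedLogPoly hn]; exact hn
  have h := resultant_deriv hdeg
  rw [natDegree_truncatedLogPoly hn, leadingCoeff_truncatedLogPoly hn,
    derivative_truncatedLogPoly] at h
  have hR : (clearedResultant L n : ℚ) = (L : ℚ) ^ (n - 1) *
      resultant (truncatedLogPoly n) (∑ i ∈ range n, X ^ i) n (n - 1) := by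
    rw [← resultant_C_mul_left, ← map_clearedLogPoly hL, cast_clearedResultant]
  have hn0 : (n : ℚ) ≠ 0 := by positivity
  have hs : ((-1 : ℚ) ^ (n * (n - 1) / 2)) * (-1) ^ (n * (n - 1) / 2) = 1 := by
    rw [← mul_pow]; simp
  rw [hR, h]
  field_simp
  linear_combination -(L : ℚ) ^ (n - 1) * (truncatedLogPoly n).discr * hs

/-! ### The resultant as a product over roots of unity -/

section Field

variable {K : Type*} [Field K]

lemma monic_geom_sum {n : ℕ} (hn : 0 < n) : (∑ i ∈ range n, (X : K[X]) ^ i).Monic :=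
  monic_geom_sum_X hn.ne'

lemma natDegree_geom_sum {n : ℕ} (hn : 0 < n) :
    (∑ i ∈ range n, (X : K[X]) ^ i).natDegree = n - 1 := by
  have h := congrArg natDegree (mul_geom_sum (X : K[X]) n)
  have h1 : (X - 1 : K[X]).Monic := by simpa using monic_X_sub_C (1 : K)
  rw [h1.natDegree_mul (monic_geom_sum hn)] at h
  have h2 : (X - 1 : K[X]).natDegree = 1 := by simpa using natDegree_X_sub_C (1 : K)
  have h3 : (X ^ n - 1 : K[X]).natDegree = n := by simpa using natDegree_X_pow_sub_C (r := (1 : K))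
  omega

lemma cast_clearedResultant_eq_prod {n : ℕ} (hn : 0 < n) (L : ℕ)
    (hs : (∑ i ∈ range n, (X : K[X]) ^ i).Splits) :
    (clearedResultant L n : K) = ((∑ i ∈ range n, (X : K[X]) ^ i).roots.map
      ((clearedLogPoly L n).map (Int.castRingHom K)).eval).prod := by
  have h := resultant_eq_prod_eval (∑ i ∈ range n, (X : K[X]) ^ i)
    ((clearedLogPoly L n).map (Int.castRingHom K)) n
    (natDegree_map_le.trans (natDegree_clearedLogPoly_le L n)) hs
  rw [(monic_geom_sum hn).leadingCoeff, one_pow, one_mul, natDegree_geom_sum hn] at h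
  rw [cast_clearedResultant, resultant_comm, h, (Nat.even_mul_pred_self n).neg_one_pow, one_mul]

/-- The root z = 1 is not excluded: it is a genuine root of F_n' when the characteristic divides n.
-/
lemma exists_common_root_of_clearedResultant_eq_zero [IsAlgClosed K] {L n : ℕ} (hn : 0 < n)
    (h : (clearedResultant L n : K) = 0) :
    ∃ z : K, z ^ n = 1 ∧ ((clearedLogPoly L n).map (Int.castRingHom K)).eval z = 0 := by
  rw [cast_clearedResultant_eq_prod hn L (IsAlgClosed.splits _), Multiset.prod_eq_zero_iff,
    Multiset.mem_map] at h
  obtain ⟨z, hz, h0⟩ := h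
  refine ⟨z, ?_, h0⟩
  have hz' := (mem_roots'.1 hz).2
  have h1 := congrArg (eval z) (mul_geom_sum (X : K[X]) n)
  rw [eval_mul, hz'.eq_zero, mul_zero] at h1
  simp only [eval_sub, eval_pow, eval_X, eval_one] at h1
  exact (sub_eq_zero.1 h1.symm)

lemma cast_clearedResultant_of_isPrimitiveRoot {n : ℕ} (hn : 0 < n) (L : ℕ) {ζ : K}
    (hζ : IsPrimitiveRoot ζ n) :
    (clearedResultant L n : K) = ∏ i ∈ range (n - 1),
      ((clearedLogPoly L n).map (Int.castRingHom K)).eval (ζ ^ (i + 1)) := by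
  classical
  have hfac : (∑ i ∈ range n, (X : K[X]) ^ i) =
      (((Multiset.range (n - 1)).map fun i => ζ ^ (i + 1)).map fun a => X - C a).prod := by
    have h1 : (X - 1 : K[X]) ≠ 0 := by simpa using X_sub_C_ne_zero (1 : K)
    refine mul_left_cancel₀ h1 ?_
    rw [mul_geom_sum, X_pow_sub_one_eq_prod hn hζ]
    have himg : nthRootsFinset n (1 : K) = (range n).image fun i => ζ ^ i := by
      symm
      refine Finset.eq_of_subset_of_card_le ?_ ?_
      · intro x hx
        obtain ⟨i, -, rfl⟩ := Finset.mem_image.1 hx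
        rw [mem_nthRootsFinset hn, ← pow_mul, mul_comm, pow_mul, hζ.pow_eq_one, one_pow]
      · rw [hζ.card_nthRootsFinset, Finset.card_image_of_injOn, card_range]
        intro i hi j hj hij
        exact hζ.pow_inj (by simpa using hi) (by simpa using hj) hij
    rw [himg, Finset.prod_image]
    · obtain ⟨m, rfl⟩ := Nat.exists_eq_add_of_lt hn
      simp only [zero_add, Nat.add_sub_cancel]
      rw [Finset.prod_range_succ', mul_comm]
      simp [Finset.prod, Multiset.map_map]
    · intro i hi j hj hij
      exact hζ.pow_inj (by simpa using hi) (by simpa using hj) hij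
  have hroots := congrArg roots hfac
  rw [roots_multiset_prod_X_sub_C] at hroots
  rw [cast_clearedResultant_eq_prod hn, hroots, Multiset.map_map]
  · rfl
  · rw [hfac]
    refine Splits.multisetProd fun f hf => ?_
    obtain ⟨a, -, rfl⟩ := Multiset.mem_map.1 hf
    exact Splits.X_sub_C a

end Field

/-! ### Reduction modulo a prime -/

section Reduction

variable {ℓ : ℕ} [Fact ℓ.Prime]

lemma exists_common_denominator (ℓ n : ℕ) [hℓ : Fact ℓ.Prime] :
    ∃ u : ℕ, ¬ ℓ ∣ u ∧ ∀ k ∈ Icc 1 n, k ∣ ℓ ^ Nat.log ℓ n * u := by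
  refine ⟨∏ k ∈ Icc 1 n, ordCompl[ℓ] k, ?_, fun k hk => ?_⟩
  · rw [hℓ.out.prime.dvd_finsetProd_iff]
    rintro ⟨k, hk, h⟩
    exact Nat.not_dvd_ordCompl hℓ.out (by have := (Finset.mem_Icc.1 hk).1; omega) h
  · have h0 : k ≠ 0 := by have := (Finset.mem_Icc.1 hk).1; omega
    rw [← Nat.ordProj_mul_ordCompl_eq_self k ℓ]
    refine mul_dvd_mul (pow_dvd_pow _ ?_) (Finset.dvd_prod_of_mem (fun k => ordCompl[ℓ] k) hk)
    exact Nat.le_log_of_pow_le hℓ.out.one_lt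
      ((Nat.ordProj_le ℓ h0).trans (Finset.mem_Icc.1 hk).2)

lemma map_clearedLogPoly_charP {K : Type*} [Field K] [CharP K ℓ] {n m u : ℕ} (hm : m ≠ 0)
    (hL : ∀ k ∈ Icc 1 n, k ∣ ℓ ^ m * u) :
    (clearedLogPoly (ℓ ^ m * u) n).map (Int.castRingHom K) =
      ∑ j ∈ Icc 1 (n / ℓ ^ m), C ((u / j : ℕ) : K) * X ^ (j * ℓ ^ m) := by
  have hℓ : ℓ.Prime := Fact.out
  have hpos : 0 < ℓ ^ m := pow_pos hℓ.pos _
  simp only [clearedLogPoly, Polynomial.map_add, Polynomial.map_sum,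
    Polynomial.map_mul, Polynomial.map_pow, map_X, map_C, Int.coe_castRingHom, Int.cast_natCast]
  have h0 : ((ℓ ^ m * u : ℕ) : K) = 0 := by simp [hm]
  rw [h0, C_0, zero_add]
  symm
  have himg : ∑ j ∈ Icc 1 (n / ℓ ^ m), C ((u / j : ℕ) : K) * X ^ (j * ℓ ^ m) =
      ∑ k ∈ (Icc 1 (n / ℓ ^ m)).image (· * ℓ ^ m),
        C ((ℓ ^ m * u / k : ℕ) : K) * X ^ k := by
    rw [Finset.sum_image fun i _ j _ hij => Nat.eq_of_mul_eq_mul_right hpos hij]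
    refine Finset.sum_congr rfl fun j _ => ?_
    rw [mul_comm j, Nat.mul_div_mul_left _ _ hpos]
  rw [himg]
  refine Finset.sum_subset ?_ fun k hk hk' => ?_
  · intro k hk
    obtain ⟨j, hj, rfl⟩ := Finset.mem_image.1 hk
    rw [Finset.mem_Icc] at hj ⊢
    exact ⟨Nat.mul_pos hj.1 hpos, (Nat.le_div_iff_mul_le hpos).1 hj.2⟩
  -- As k * (L / k) = ℓ^m u, either ℓ divides L / k or all of ℓ^m divides k.
  · have hdvd : ℓ ∣ ℓ ^ m * u / k := by
      by_contra hc
      have hmul := Nat.mul_div_cancel' (hL k hk)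
      have hcop : (ℓ ^ m).Coprime (ℓ ^ m * u / k) :=
        Nat.Coprime.pow_left _ ((Nat.Prime.coprime_iff_not_dvd hℓ).2 hc)
      have hk2 : ℓ ^ m ∣ k := hcop.dvd_of_dvd_mul_right (by rw [hmul]; exact dvd_mul_right _ _)
      obtain ⟨j, rfl⟩ := hk2
      refine hk' (Finset.mem_image.2 ⟨j, ?_, mul_comm _ _⟩)
      rw [Finset.mem_Icc] at hk ⊢
      refine ⟨Nat.pos_of_mul_pos_left hk.1, ?_⟩
      rw [Nat.le_div_iff_mul_le hpos, mul_comm]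
      exact hk.2
    rw [(CharP.cast_eq_zero_iff K ℓ _).2 hdvd, C_0, zero_mul]

/-- If the leading digit of `n` in base `ℓ` is `1`, the resultant is a unit modulo `ℓ`. -/
lemma cast_clearedResultant_of_leading_digit_one {n m u : ℕ} (hm : m ≠ 0)
    (h1 : ℓ ^ m ≤ n) (h2 : n < 2 * ℓ ^ m) (hL : ∀ k ∈ Icc 1 n, k ∣ ℓ ^ m * u) :
    (clearedResultant (ℓ ^ m * u) n : ZMod ℓ) =
      (-1) ^ ((n - 1) * (n - ℓ ^ m)) * (u : ZMod ℓ) ^ (n - 1) := by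
  have hpos : 0 < ℓ ^ m := pow_pos (Fact.out : ℓ.Prime).pos _
  have hn : 0 < n := hpos.trans_le h1
  have hdiv : n / ℓ ^ m = 1 := Nat.div_eq_of_lt_le (by omega) (by omega)
  have hlead : (∑ i ∈ range n, (X : (ZMod ℓ)[X]) ^ i).coeff (n - 1) = 1 := by
    have := (monic_geom_sum (K := ZMod ℓ) hn).coeff_natDegree
    rwa [natDegree_geom_sum hn] at this
  have hzero : (∑ i ∈ range n, (X : (ZMod ℓ)[X]) ^ i).coeff 0 = 1 := by
    simp [finsetSum_coeff, coeff_X_pow, hn]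
  rw [cast_clearedResultant, map_clearedLogPoly_charP hm hL, hdiv, Finset.Icc_self,
    Finset.sum_singleton, Nat.div_one, one_mul, resultant_C_mul_left]
  obtain ⟨k, rfl⟩ := Nat.exists_eq_add_of_le h1
  -- Lowering the formal degree from n to ℓ^m costs only a sign, the other polynomial being monic;
  -- then Res(X^N, G) is G(0)^N up to sign.
  rw [resultant_add_left_deg _ _ _ _ _ (natDegree_X_pow_le _), hlead,
    resultant_X_pow_left _ _ _ (natDegree_geom_sum hn).le, hzero]
  simp [mul_comm]

end Reduction

/-! ### Criteria for a non-square discriminant -/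

lemma not_isSquare_discr_of_odd_valuation {ℓ n m u : ℕ} [Fact ℓ.Prime] (hn : 0 < n)
    (hu : ¬ ℓ ∣ u) (hL : ∀ k ∈ Icc 1 n, k ∣ ℓ ^ m * u)
    (hR : (clearedResultant (ℓ ^ m * u) n : ZMod ℓ) ≠ 0)
    (hodd : Odd (padicValNat ℓ n + m * (n - 1))) :
    ¬ IsSquare (truncatedLogPoly n).discr := by
  have hℓ : ℓ.Prime := Fact.out
  rintro ⟨s, hs⟩
  have h := pow_mul_discr_truncatedLogPoly hn hL
  set R := clearedResultant (ℓ ^ m * u) n with hRdef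
  have hRdvd : ¬ (ℓ : ℤ) ∣ R := fun hd => hR ((ZMod.intCast_zmod_eq_zero_iff_dvd R ℓ).2 hd)
  have hR0 : (R : ℚ) ≠ 0 := by
    intro h0
    exact hRdvd (by rw [Int.cast_eq_zero.1 h0]; exact dvd_zero _)
  have hn0 : (n : ℚ) ≠ 0 := by positivity
  have hu0 : (u : ℚ) ≠ 0 := by
    intro h0
    exact hu (by rw [Nat.cast_eq_zero.1 h0]; exact dvd_zero _)
  have hℓ0 : (ℓ : ℚ) ≠ 0 := by exact_mod_cast hℓ.ne_zero
  have hsgn : ((-1 : ℚ) ^ (n * (n - 1) / 2)) ≠ 0 := by simp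
  have hs0 : s ≠ 0 := by
    rintro rfl
    rw [hs, mul_zero, mul_zero] at h
    exact mul_ne_zero (mul_ne_zero hsgn hn0) hR0 h.symm
  have hv := congrArg (padicValRat ℓ) h
  have hsgnv : padicValRat ℓ ((-1 : ℚ) ^ (n * (n - 1) / 2)) = 0 := by
    rw [padicValRat.pow, padicValRat.neg, padicValRat.one, mul_zero]
  have huv : padicValRat ℓ (u : ℚ) = 0 := by
    rw [padicValRat.of_nat, padicValNat.eq_zero_of_not_dvd hu]; rfl
  have hRv : padicValRat ℓ (R : ℚ) = 0 := by
    rw [padicValRat.of_int, padicValInt.eq_zero_of_not_dvd hRdvd]; rfl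
  have hLv : padicValRat ℓ ((ℓ ^ m * u : ℕ) : ℚ) = m := by
    rw [Nat.cast_mul, Nat.cast_pow, padicValRat.mul (pow_ne_zero _ hℓ0) hu0, huv,
      padicValRat.pow, padicValRat.self hℓ.one_lt]
    ring
  have hL0 : ((ℓ ^ m * u : ℕ) : ℚ) ≠ 0 := by
    rw [Nat.cast_mul, Nat.cast_pow]
    exact mul_ne_zero (pow_ne_zero _ hℓ0) hu0
  rw [hs, padicValRat.mul (pow_ne_zero _ hL0) (mul_ne_zero hs0 hs0), padicValRat.pow, hLv,
    padicValRat.mul hs0 hs0, padicValRat.mul (mul_ne_zero hsgn hn0) hR0,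
    padicValRat.mul hsgn hn0, hsgnv, hRv, padicValRat.of_nat] at hv
  have hodd' : Odd ((padicValNat ℓ n : ℤ) + (n - 1 : ℕ) * m) := by
    have := (Int.odd_coe_nat _).2 hodd
    rwa [Nat.cast_add, Nat.cast_mul, mul_comm (m : ℤ)] at this
  have heven : (padicValNat ℓ n : ℤ) + (n - 1 : ℕ) * m =
      ((n - 1 : ℕ) * m + padicValRat ℓ s) + ((n - 1 : ℕ) * m + padicValRat ℓ s) := by
    linarith
  exact (Int.not_even_iff_odd.2 hodd') ⟨_, heven⟩

lemma isSquare_mul_clearedResultant {L n : ℕ} (hn : n % 4 = 1) (hL : ∀ k ∈ Icc 1 n, k ∣ L)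
    (hsq : IsSquare (truncatedLogPoly n).discr) (ℓ : ℕ) :
    IsSquare ((n : ZMod ℓ) * (clearedResultant L n : ZMod ℓ)) := by
  obtain ⟨k, rfl⟩ : ∃ k, n = 4 * k + 1 := ⟨n / 4, by omega⟩
  have h := pow_mul_discr_truncatedLogPoly (by omega) hL
  have he : Even ((4 * k + 1) * (4 * k + 1 - 1) / 2) := by
    refine ⟨(4 * k + 1) * k, ?_⟩
    rw [Nat.add_sub_cancel, show (4 * k + 1) * (4 * k) = ((4 * k + 1) * k + (4 * k + 1) * k) * 2 by
      ring, Nat.mul_div_cancel _ two_pos]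
  rw [he.neg_one_pow, one_mul] at h
  have hQ : IsSquare (((4 * k + 1 : ℕ) * clearedResultant L (4 * k + 1) : ℤ) : ℚ) := by
    push_cast
    push_cast at h
    rw [← h]
    refine IsSquare.mul (Even.isSquare_pow ⟨2 * k, by omega⟩ _) hsq
  have hZ := (Rat.isSquare_intCast_iff.1 hQ).map (Int.castRingHom (ZMod ℓ))
  simpa using hZ

/-- Here R ≡ u^(n-1) mod ℓ with n - 1 even, so n R being a square would make n one. -/
lemma not_isSquare_discr_of_nonresidue {n ℓ : ℕ} (hp : ℓ.Prime) (hn : n % 4 = 1)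
    (h1 : ℓ ≤ n) (h2 : n < 2 * ℓ) (hℓ : 2 < ℓ) (hres : ¬ IsSquare (n : ZMod ℓ)) :
    ¬ IsSquare (truncatedLogPoly n).discr := by
  intro hsq
  have : Fact ℓ.Prime := ⟨hp⟩
  obtain ⟨u, hu, hL⟩ := exists_common_denominator ℓ n
  have hlog : Nat.log ℓ n = 1 := by
    rw [Nat.log_eq_one_iff']
    exact ⟨h1, h2.trans_le (Nat.mul_le_mul_right _ hℓ.le)⟩
  rw [hlog] at hL
  have h := isSquare_mul_clearedResultant hn hL hsq ℓ
  have he : Even (n - 1) := ⟨(n - 1) / 2, by omega⟩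
  rw [cast_clearedResultant_of_leading_digit_one one_ne_zero (by simpa) (by simpa) hL,
    (he.mul_right _).neg_one_pow, one_mul] at h
  have hu0 : (u : ZMod ℓ) ≠ 0 := fun h0 => hu ((ZMod.natCast_eq_zero_iff _ _).1 h0)
  have h' := h.div (he.isSquare_pow (u : ZMod ℓ))
  rw [mul_div_cancel_right₀ _ (pow_ne_zero _ hu0)] at h'
  exact hres h'

lemma not_isSquare_discr_of_coprime {p q : ℕ} [hqF : Fact q.Prime] (hp : 0 < p) (hpq : p < q)
    (hodd : Odd (p * q))
    (hcop : ∀ w : AlgebraicClosure (ZMod q), w ^ p = 1 →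
      (∀ j ∈ Icc 1 p, (j : AlgebraicClosure (ZMod q)) ≠ 0) →
      ∑ j ∈ Icc 1 p, w ^ j / j ≠ 0) :
    ¬ IsSquare (truncatedLogPoly (p * q)).discr := by
  have hq := hqF.out
  have hn : 0 < p * q := Nat.mul_pos hp hq.pos
  obtain ⟨u, hu, hL⟩ := exists_common_denominator q (p * q)
  have hlog : Nat.log q (p * q) = 1 := by
    rw [Nat.log_eq_one_iff']
    exact ⟨Nat.le_mul_of_pos_left _ hp, Nat.mul_lt_mul_of_pos_right hpq hq.pos⟩
  rw [hlog] at hL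
  refine not_isSquare_discr_of_odd_valuation (ℓ := q) hn hu hL ?_ ?_
  · intro h0
    have h0' : (clearedResultant (q ^ 1 * u) (p * q) : AlgebraicClosure (ZMod q)) = 0 := by
      rw [← map_intCast (algebraMap (ZMod q) (AlgebraicClosure (ZMod q))), h0, map_zero]
    obtain ⟨z, hz, hPz⟩ := exists_common_root_of_clearedResultant_eq_zero hn h0'
    have hpne : ∀ j ∈ Icc 1 p, (j : AlgebraicClosure (ZMod q)) ≠ 0 := by
      intro j hj h
      rw [Finset.mem_Icc] at hj
      exact absurd (Nat.le_of_dvd hj.1 ((CharP.cast_eq_zero_iff _ q j).1 h)) (by omega)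
    -- The reduction is a polynomial in X^q, so w = z^q is the natural variable.
    refine hcop (z ^ q) (by rw [← pow_mul, mul_comm, hz]) hpne ?_
    rw [map_clearedLogPoly_charP one_ne_zero hL, pow_one, Nat.mul_div_cancel _ hq.pos] at hPz
    simp only [eval_finsetSum, eval_mul, eval_C, eval_pow, eval_X] at hPz
    have hu0 : (u : AlgebraicClosure (ZMod q)) ≠ 0 :=
      fun h0 => hu ((CharP.cast_eq_zero_iff _ q _).1 h0)
    refine (mul_eq_zero.1 (Eq.trans ?_ hPz)).resolve_left hu0
    rw [Finset.mul_sum]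
    refine Finset.sum_congr rfl fun j hj => ?_
    have hju : j ∣ u := by
      have hjq : j * q ∈ Icc 1 (p * q) := by
        rw [Finset.mem_Icc] at hj ⊢
        exact ⟨Nat.mul_pos hj.1 hq.pos, Nat.mul_le_mul_right _ hj.2⟩
      have := hL _ hjq
      rw [pow_one, mul_comm] at this
      exact Nat.dvd_of_mul_dvd_mul_left hq.pos this
    rw [Nat.cast_div hju (hpne j hj)]
    ring
  · have hv : padicValNat q (p * q) = 1 := by
      rw [padicValNat.mul hp.ne' hq.ne_zero, padicValNat_self,
        padicValNat.eq_zero_of_not_dvd fun h => absurd (Nat.le_of_dvd hp h) (by omega)]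
    rw [hv, one_mul]
    obtain ⟨k, hk⟩ := hodd
    exact ⟨k, by omega⟩

lemma not_isSquare_discr_of_even {n ℓ : ℕ} [Fact ℓ.Prime] (hn : Even n)
    (h1 : ℓ < n) (h2 : n < 2 * ℓ) (hℓ : 2 < ℓ) :
    ¬ IsSquare (truncatedLogPoly n).discr := by
  obtain ⟨u, hu, hL⟩ := exists_common_denominator ℓ n
  have hlog : Nat.log ℓ n = 1 := by
    rw [Nat.log_eq_one_iff']
    exact ⟨h1.le, h2.trans_le (Nat.mul_le_mul_right _ hℓ.le)⟩
  rw [hlog] at hL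
  refine not_isSquare_discr_of_odd_valuation (by omega) hu hL ?_ ?_
  · rw [cast_clearedResultant_of_leading_digit_one one_ne_zero (by simpa using h1.le)
      (by simpa) hL]
    have hu0 : (u : ZMod ℓ) ≠ 0 := fun h0 => hu ((ZMod.natCast_eq_zero_iff _ _).1 h0)
    exact mul_ne_zero (by simp) (pow_ne_zero _ hu0)
  · rw [padicValNat.eq_zero_of_not_dvd, one_mul, zero_add]
    · obtain ⟨k, hk⟩ := hn
      exact ⟨k - 1, by omega⟩
    · rintro ⟨k, rfl⟩
      have : 1 < k := by by_contra!; interval_cases k <;> omega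
      have : k < 2 := by by_contra!; nlinarith
      omega

/-- For odd n the roots of unity other than 1 form conjugate pairs, so the product is a squared
modulus. -/
lemma clearedResultant_nonneg_of_odd (L m : ℕ) : 0 ≤ clearedResultant L (2 * m + 1) := by
  have hζ := Complex.isPrimitiveRoot_exp (2 * m + 1) (by omega)
  set ζ := Complex.exp (2 * Real.pi * Complex.I / (2 * m + 1 : ℕ)) with hζdef
  set f : ℂ → ℂ := ((clearedLogPoly L (2 * m + 1)).map (Int.castRingHom ℂ)).eval with hf
  have hconj : ∀ z, f (starRingEnd ℂ z) = starRingEnd ℂ (f z) := by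
    intro z
    simp only [hf, eval_map, hom_eval₂]
    congr 1
    exact Subsingleton.elim _ _
  have hnorm : starRingEnd ℂ ζ = ζ⁻¹ :=
    (Complex.inv_eq_conj (hζ.norm'_eq_one (by omega))).symm
  have hζ0 : ζ ≠ 0 := Complex.exp_ne_zero _
  have h : (clearedResultant L (2 * m + 1) : ℂ) =
      (Complex.normSq (∏ i ∈ range m, f (ζ ^ (i + 1))) : ℝ) := by
    rw [cast_clearedResultant_of_isPrimitiveRoot (by omega) L hζ, Nat.add_sub_cancel]
    change ∏ i ∈ range (2 * m), f (ζ ^ (i + 1)) = _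
    nth_rw 1 [two_mul]
    rw [Finset.prod_range_add, ← Complex.mul_conj, map_prod,
      ← Finset.prod_range_reflect (fun i => f (ζ ^ (m + i + 1)))]
    congr 1
    refine Finset.prod_congr rfl fun i hi => ?_
    rw [← hconj, map_pow, hnorm]
    congr 1
    have him : i < m := Finset.mem_range.1 hi
    refine eq_inv_of_mul_eq_one_left ?_ |>.trans (inv_pow _ _).symm
    rw [← pow_add, ← hζ.pow_eq_one]
    congr 1
    omega
  have h' : ((clearedResultant L (2 * m + 1) : ℤ) : ℝ) =
      Complex.normSq (∏ i ∈ range m, f (ζ ^ (i + 1))) := by exact_mod_cast h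
  exact_mod_cast h'.symm ▸ Complex.normSq_nonneg _

lemma not_isSquare_discr_of_mod_four_eq_three {n : ℕ} (hn : n % 4 = 3) :
    ¬ IsSquare (truncatedLogPoly n).discr := by
  intro hsq
  obtain ⟨k, rfl⟩ : ∃ k, n = 2 * (2 * k + 1) + 1 := ⟨n / 4, by omega⟩
  set n := 2 * (2 * k + 1) + 1 with hndef
  have : Fact (Nat.Prime 2) := ⟨Nat.prime_two⟩
  obtain ⟨u, hu, hL⟩ := exists_common_denominator 2 n
  have hlog : Nat.log 2 n ≠ 0 := (Nat.log_pos one_lt_two (by omega)).ne'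
  -- The leading binary digit of n is always 1, so R is odd.
  have hR0 : clearedResultant (2 ^ Nat.log 2 n * u) n ≠ 0 := by
    intro h0
    have h := cast_clearedResultant_of_leading_digit_one hlog
      (Nat.pow_log_le_self 2 (by omega)) (by
        have := Nat.lt_pow_succ_log_self one_lt_two n
        rwa [pow_succ'] at this) hL
    have hu0 : (u : ZMod 2) ≠ 0 := fun h0 => hu ((ZMod.natCast_eq_zero_iff _ _).1 h0)
    rw [h0, Int.cast_zero] at h
    exact mul_ne_zero (by simp) (pow_ne_zero _ hu0) h.symm
  have hR : 0 < clearedResultant (2 ^ Nat.log 2 n * u) n :=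
    lt_of_le_of_ne (clearedResultant_nonneg_of_odd _ _) hR0.symm
  have h := pow_mul_discr_truncatedLogPoly (by omega) hL
  have hexp : Odd (n * (n - 1) / 2) := by
    have : n * (n - 1) / 2 = n * (2 * k + 1) := by
      rw [show n * (n - 1) = n * (2 * k + 1) * 2 by rw [hndef, Nat.add_sub_cancel]; ring,
        Nat.mul_div_cancel _ two_pos]
    rw [this]
    exact Odd.mul ⟨2 * k + 1, rfl⟩ ⟨k, rfl⟩
  rw [hexp.neg_one_pow] at h
  have hRq : (0 : ℚ) < clearedResultant (2 ^ Nat.log 2 n * u) n := by exact_mod_cast hR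
  have hnq : (0 : ℚ) < n := by rw [hndef]; positivity
  have hlhs : 0 ≤ ((2 ^ Nat.log 2 n * u : ℕ) : ℚ) ^ (n - 1) * (truncatedLogPoly n).discr :=
    mul_nonneg (by positivity) hsq.nonneg
  rw [h] at hlhs
  nlinarith [mul_pos hnq hRq]

/-! ### The squares n = 9, 25, 49 -/

lemma eval_map_clearedLogPoly {K : Type*} [CommRing K] (L n : ℕ) (z : K) :
    ((clearedLogPoly L n).map (Int.castRingHom K)).eval z =
      L + ∑ k ∈ Icc 1 n, ((L / k : ℕ) : K) * z ^ k := by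
  simp only [clearedLogPoly, Polynomial.map_add, Polynomial.map_sum, Polynomial.map_mul,
    Polynomial.map_pow, map_X, map_C, Int.coe_castRingHom, Int.cast_natCast, eval_add,
    eval_finsetSum, eval_mul, eval_pow, eval_X, eval_C]

/-- When n is itself a square, it is a residue everywhere, so R must be the nonresidue. A prime ℓ ≡
1 mod n contains the roots of unity, and R mod ℓ becomes a computable product. -/
lemma not_isSquare_discr_of_primitive_root {n ℓ g : ℕ} (hℓ : ℓ.Prime) (hn : n % 4 = 1)
    (hg : IsPrimitiveRoot (g : ZMod ℓ) n) (r : ℕ)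
    (hr : (∏ i ∈ range (n - 1),
      (n.factorial + ∑ k ∈ Icc 1 n, n.factorial / k * (g ^ (i + 1)) ^ k)) % ℓ = r % ℓ)
    (hres : ¬ IsSquare ((n * r : ℕ) : ZMod ℓ)) :
    ¬ IsSquare (truncatedLogPoly n).discr := by
  intro hsq
  have : Fact ℓ.Prime := ⟨hℓ⟩
  have hL : ∀ k ∈ Icc 1 n, k ∣ n.factorial := fun k hk =>
    Nat.dvd_factorial (Finset.mem_Icc.1 hk).1 (Finset.mem_Icc.1 hk).2
  have h := isSquare_mul_clearedResultant hn hL hsq ℓ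
  rw [cast_clearedResultant_of_isPrimitiveRoot (by omega) _ hg] at h
  refine hres ?_
  rw [Nat.cast_mul, ← (ZMod.natCast_eq_natCast_iff' _ _ _).2 hr]
  convert! h using 2
  rw [Nat.cast_prod]
  refine Finset.prod_congr rfl fun i _ => ?_
  rw [eval_map_clearedLogPoly]
  push_cast
  rfl

lemma not_isSquare_discr_nine : ¬ IsSquare (truncatedLogPoly 9).discr := by
  have hg : IsPrimitiveRoot ((2 : ℕ) : ZMod 73) (3 ^ (1 + 1)) := by
    have : Fact (Nat.Prime 3) := ⟨by norm_num⟩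
    rw [IsPrimitiveRoot.iff_orderOf]
    exact orderOf_eq_prime_pow (by decide +kernel) (by decide +kernel)
  exact not_isSquare_discr_of_primitive_root (ℓ := 73) (g := 2) (by norm_num) (by norm_num) hg
    52 (by decide +kernel) (by decide +kernel)

lemma not_isSquare_discr_twenty_five : ¬ IsSquare (truncatedLogPoly 25).discr := by
  have hg : IsPrimitiveRoot ((9 : ℕ) : ZMod 151) (5 ^ (1 + 1)) := by
    have : Fact (Nat.Prime 5) := ⟨by norm_num⟩
    rw [IsPrimitiveRoot.iff_orderOf]
    exact orderOf_eq_prime_pow (by decide +kernel) (by decide +kernel)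
  exact not_isSquare_discr_of_primitive_root (ℓ := 151) (g := 9) (by norm_num) (by norm_num) hg
    119 (by decide +kernel) (by decide +kernel)

lemma not_isSquare_discr_forty_nine : ¬ IsSquare (truncatedLogPoly 49).discr := by
  have hg : IsPrimitiveRoot ((16 : ℕ) : ZMod 197) (7 ^ (1 + 1)) := by
    have : Fact (Nat.Prime 7) := ⟨by norm_num⟩
    rw [IsPrimitiveRoot.iff_orderOf]
    exact orderOf_eq_prime_pow (by decide +kernel) (by decide +kernel)
  exact not_isSquare_discr_of_primitive_root (ℓ := 197) (g := 16) (by norm_num) (by norm_num) hg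
    72 (by decide +kernel) (by decide +kernel)


/-! ### Primes q > p and their exceptions -/

lemma prime_214419169597 : Nat.Prime 214419169597 := by
  refine lucas_primality _ 2 (by reduce_mod_char) fun r hr hd => ?_
  -- Pratt certificate: the list factors the prime minus one.
  have hmem : r ∈ [2, 2, 3, 1231, 14515243] :=
    mem_list_primes_of_dvd_prod hr.prime (by norm_num [← Nat.prime_iff]) (by simpa using hd)
  fin_cases hmem <;> norm_num <;> reduce_mod_char <;> decide +kernel

lemma prime_1170728665999621 : Nat.Prime 1170728665999621 := by
  refine lucas_primality _ 10 (by reduce_mod_char) fun r hr hd => ?_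
  have hmem : r ∈ [2, 2, 3, 5, 7, 13, 214419169597] :=
    mem_list_primes_of_dvd_prod hr.prime
      (by
        simp only [List.forall_mem_cons, ← Nat.prime_iff]
        refine ⟨?_, ?_, ?_, ?_, ?_, ?_, prime_214419169597, by simp⟩ <;> norm_num) (by simpa using hd)
  fin_cases hmem <;> norm_num <;> reduce_mod_char <;> decide +kernel

lemma not_isSquare_discr_three_mul {q : ℕ} (hq : q.Prime) (h : 3 < q) :
    ¬ IsSquare (truncatedLogPoly (3 * q)).discr := by
  have : Fact q.Prime := ⟨hq⟩
  have hodd : Odd q := hq.odd_of_ne_two (by omega)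
  -- 143 = 11 · 13 is the Bézout constant of 6w + 3w² + 2w³ and w³ - 1; the final
  -- `linear_combination` holds the cofactors.
  by_cases hd : q ∣ 143
  · have hmem : q ∈ [11, 13] :=
      mem_list_primes_of_dvd_prod hq.prime (by norm_num [← Nat.prime_iff]) (by simpa using hd)
    simp only [List.mem_cons, List.not_mem_nil, or_false] at hmem
    rcases hmem with rfl | rfl
    · exact not_isSquare_discr_of_nonresidue (ℓ := 19) (by norm_num) (by norm_num) (by norm_num)
        (by norm_num) (by norm_num) (by decide +kernel)
    · exact not_isSquare_discr_of_mod_four_eq_three (by norm_num)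
  · refine not_isSquare_discr_of_coprime (by norm_num) h (Odd.mul (by decide) hodd) ?_
    intro w hw hne hs
    apply hd
    rw [← CharP.cast_eq_zero_iff (AlgebraicClosure (ZMod q)) q]
    have h2 := hne 2 (by simp)
    have h3 := hne 3 (by simp)
    simp [Finset.sum_Icc_succ_top] at hs h2 h3
    field_simp at hs
    have key : 6 * w ^ 1 + 3 * w ^ 2 + 2 * w ^ 3 = 0 := by
      linear_combination hs
    push_cast
    linear_combination
      ((-14) + (-3) * w + (30) * w ^ 2) * key - ((143) + (84) * w + (60) * w ^ 2) * hw

lemma not_isSquare_15005 : ¬ IsSquare ((5 * 3001 : ℕ) : ZMod 7507) := by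
  have : Fact (Nat.Prime 7507) := ⟨by norm_num⟩
  have h : legendreSym 7507 (15005 : ℤ) = -1 := by norm_num
  simpa using (legendreSym.eq_neg_one_iff 7507).1 h

lemma not_isSquare_discr_five_mul {q : ℕ} (hq : q.Prime) (h : 5 < q) :
    ¬ IsSquare (truncatedLogPoly (5 * q)).discr := by
  have : Fact q.Prime := ⟨hq⟩
  have hodd : Odd q := hq.odd_of_ne_two (by omega)
  by_cases hd : q ∣ 456773207
  · have hmem : q ∈ [11, 101, 137, 3001] :=
      mem_list_primes_of_dvd_prod hq.prime (by norm_num [← Nat.prime_iff]) (by simpa using hd)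
    simp only [List.mem_cons, List.not_mem_nil, or_false] at hmem
    rcases hmem with rfl | rfl | rfl | rfl
    · exact not_isSquare_discr_of_mod_four_eq_three (by norm_num)
    · exact not_isSquare_discr_of_nonresidue (ℓ := 269) (by norm_num) (by norm_num) (by norm_num)
        (by norm_num) (by norm_num) (by decide +kernel)
    · exact not_isSquare_discr_of_nonresidue (ℓ := 347) (by norm_num) (by norm_num) (by norm_num)
        (by norm_num) (by norm_num) (by decide +kernel)
    · exact not_isSquare_discr_of_nonresidue (ℓ := 7507) (by norm_num) (by norm_num) (by norm_num)
        (by norm_num) (by norm_num) (by exact not_isSquare_15005)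
  · refine not_isSquare_discr_of_coprime (by norm_num) h (Odd.mul (by decide) hodd) ?_
    intro w hw hne hs
    apply hd
    rw [← CharP.cast_eq_zero_iff (AlgebraicClosure (ZMod q)) q]
    have h2 := hne 2 (by simp)
    have h3 := hne 3 (by simp)
    have h4 := hne 4 (by simp)
    have h5 := hne 5 (by simp)
    simp [Finset.sum_Icc_succ_top] at hs h2 h3 h4 h5
    field_simp at hs
    have key : 60 * w ^ 1 + 30 * w ^ 2 + 20 * w ^ 3 + 15 * w ^ 4 + 12 * w ^ 5 = 0 := by
      -- The cleared denominator is 5! = 2 · 60, whereas lcm(1, …, 5) = 60.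
      refine (mul_eq_zero.1 ?_).resolve_left h2
      linear_combination hs
    push_cast
    linear_combination
      ((-4099764) + (-762855) * w + (-421040) * w ^ 2 + (-292260) * w ^ 3 + (8910030) * w ^ 4) *
      key - ((456773207) + (245985840) * w + (168764220) * w ^ 2 + (130143330) * w ^ 3 +
      (106920360) * w ^ 4) * hw

lemma not_isSquare_discr_seven_mul {q : ℕ} (hq : q.Prime) (h : 7 < q) :
    ¬ IsSquare (truncatedLogPoly (7 * q)).discr := by
  have : Fact q.Prime := ⟨hq⟩
  have hodd : Odd q := hq.odd_of_ne_two (by omega)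
  by_cases hd : q ∣ 1274923517273587269
  · have hmem : q ∈ [3, 3, 11, 11, 1170728665999621] := by
      refine mem_list_primes_of_dvd_prod hq.prime ?_ (by simpa using hd)
      simp only [List.forall_mem_cons, ← Nat.prime_iff]
      refine ⟨?_, ?_, ?_, ?_, prime_1170728665999621, by simp⟩ <;> norm_num
    replace hmem : q ∈ [11, 1170728665999621] := by
      simp only [List.mem_cons, List.not_mem_nil, or_false] at hmem ⊢
      omega
    simp only [List.mem_cons, List.not_mem_nil, or_false] at hmem
    rcases hmem with rfl | rfl
    · exact not_isSquare_discr_of_nonresidue (ℓ := 43) (by norm_num) (by norm_num) (by norm_num)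
        (by norm_num) (by norm_num) (by decide +kernel)
    · exact not_isSquare_discr_of_mod_four_eq_three (by norm_num)
  · refine not_isSquare_discr_of_coprime (by norm_num) h (Odd.mul (by decide) hodd) ?_
    intro w hw hne hs
    apply hd
    rw [← CharP.cast_eq_zero_iff (AlgebraicClosure (ZMod q)) q]
    have h2 := hne 2 (by simp)
    have h3 := hne 3 (by simp)
    have h4 := hne 4 (by simp)
    have h5 := hne 5 (by simp)
    have h6 := hne 6 (by simp)
    have h7 := hne 7 (by simp)
    simp [Finset.sum_Icc_succ_top] at hs h2 h3 h4 h5 h6 h7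
    field_simp at hs
    have key : 420 * w ^ 1 + 210 * w ^ 2 + 140 * w ^ 3 + 105 * w ^ 4 + 84 * w ^ 5 + 70 * w ^ 6 + 60 * w ^ 7 = 0 := by
      refine (mul_eq_zero.1 ?_).resolve_left (mul_ne_zero h3 h4)
      linear_combination hs
    push_cast
    linear_combination
      ((-1585818765748160) + (-278640373847570) * w + (-147780835890884) * w ^ 2 +
      (-99604157211755) * w ^ 3 + (-75181470092540) * w ^ 4 + (-60562423956230) * w ^ 5 +
      (3418316692746760) * w ^ 6) * key - ((1274923517273587269) + (666043881614227200) * w +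
      (450050897823093000) * w ^ 2 + (342597056786903380) * w ^ 3 + (278388344308239340) * w ^ 4
      + (235648423054899400) * w ^ 5 + (205099001564805600) * w ^ 6) * hw

theorem proposition5p1 (q n : ℕ) (hq : q.Prime) (hn : n = 3 * q ∨ n = 5 * q ∨ n = 7 * q) :
    ¬ IsSquare (truncatedLogPoly n).discr := by
  have h5 : Fact (Nat.Prime 5) := ⟨by norm_num⟩
  have h7 : Fact (Nat.Prime 7) := ⟨by norm_num⟩
  have h11 : Fact (Nat.Prime 11) := ⟨by norm_num⟩
  rcases hn with rfl | rfl | rfl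
  · rcases lt_or_ge 3 q with h | h
    · exact not_isSquare_discr_three_mul hq h
    interval_cases q
    · exact absurd hq (by norm_num)
    · exact absurd hq (by norm_num)
    · exact not_isSquare_discr_of_even (ℓ := 5) (by decide) (by norm_num) (by norm_num)
        (by norm_num)
    · exact not_isSquare_discr_nine
  · rcases lt_or_ge 5 q with h | h
    · exact not_isSquare_discr_five_mul hq h
    interval_cases q
    · exact absurd hq (by norm_num)
    · exact absurd hq (by norm_num)
    · exact not_isSquare_discr_of_even (ℓ := 7) (by decide) (by norm_num) (by norm_num)
        (by norm_num)
    · exact not_isSquare_discr_of_mod_four_eq_three (by norm_num)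
    · exact absurd hq (by norm_num)
    · exact not_isSquare_discr_twenty_five
  · rcases lt_or_ge 7 q with h | h
    · exact not_isSquare_discr_seven_mul hq h
    interval_cases q
    · exact absurd hq (by norm_num)
    · exact absurd hq (by norm_num)
    · exact not_isSquare_discr_of_even (ℓ := 11) (by decide) (by norm_num) (by norm_num)
        (by norm_num)
    -- 21 ≡ 1 mod 4, so it is read as 3 · 7 with the larger prime as q.
    · exact not_isSquare_discr_three_mul (q := 7) (by norm_num) (by norm_num)
    · exact absurd hq (by norm_num)
    · exact not_isSquare_discr_of_mod_four_eq_three (by norm_num)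
    · exact absurd hq (by norm_num)
    · exact not_isSquare_discr_forty_nine
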